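/- For an integer $m \ge 2$, the group cone $\mathcal C(\mathbb Z_m) \subset \mathbb R^{m-1}$, with coordinates indexed by $\mathbb Z_m \setminus \{0\}$, is the set of all $x$ with $x_i + x_j \ge x_{i+j}$ for all $i, j \in \mathbb Z_m \setminus \{0\}$ with $i + j \ne 0$. A face of $\mathcal C(\mathbb Z_m)$ is the set of points of the cone at which some (possibly empty) collection of these inequalities holds with equality; its dimension is the dimension of its affine span, and its relative interior is the set of its points that lie in no face of strictly smaller dimension. A numerical semigroup is an additive submonoid $S \subseteq \mathbb Z_{\ge 0}$ with finite complement. If $m \in S$, write $\operatorname{Ap}(S;m) = \{n \in S : n - m \notin S\}$; this set has exactly one element $a_i$ in each residue class $i \in \mathbb Z_m$. A face contains $S$ if the Apéry tuple $(a_i)_{i \ne 0}$ lies in the relative interior of the face. **Theorem.** Let $a, h, k \ge 1$ and $d$ be integers with $k < a$, $\gcd(a,d) = 1$ and $ah + kd > a$. If $d < 0$, assume also that $a, ah+d, ah+2d, \ldots, ah+kd$ is a minimal generating set, i.e. none of these integers is a sum of (possibly repeated) others (for $d > 0$ this is automatic). Then $$S = \langle a, ah+d, ah+2d, \ldots, ah+kd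 \rangle$$ is a numerical semigroup (called extra-generalized arithmetical), exactly one face $F$ of $\mathcal C(\mathbb Z_a)$ contains $S$, and $$\dim F = \begin{cases} a-1 & \text{if } k = a-1; \\ \lfloor a/2 \rfloor & \text{if } k = a-2; \\ 2 & \text{if } 1 < k < a-2; \\ 1 & \text{if } k = 1. \end{cases}$$ -/

import Mathlib

/-- The group cone `C(G)`: real vectors indexed by `G \ {0}` with `x i + x j ≥ x (i + j)`
whenever `i`, `j` and `i + j` are all nonzero. -/
def groupCone (G : Type*) [AddCommGroup G] : Set ({g : G // g ≠ 0} → ℝ) :=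
  {x | ∀ i j : {g : G // g ≠ 0}, ∀ hij : (i : G) + j ≠ 0, x ⟨(i : G) + j, hij⟩ ≤ x i + x j}

/-- The facet of `C(G)` cut out by the equation `x i + x j = x (i + j)`. -/
def groupConeFacet (G : Type*) [AddCommGroup G] (i j : {g : G // g ≠ 0})
    (hij : (i : G) + j ≠ 0) : Set ({g : G // g ≠ 0} → ℝ) :=
  {x | x ∈ groupCone G ∧ x i + x j = x ⟨(i : G) + j, hij⟩}

/-- A face of `C(G)` is the intersection (inside `C(G)`) of some collection of facets;
the empty collection gives `C(G)` itself. -/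
def IsGroupConeFace (G : Type*) [AddCommGroup G] (F : Set ({g : G // g ≠ 0} → ℝ)) : Prop :=
  ∃ E : Set ({g : G // g ≠ 0} × {g : G // g ≠ 0}),
    F = {x | x ∈ groupCone G ∧
      ∀ i j : {g : G // g ≠ 0}, ∀ hij : (i : G) + j ≠ 0, (i, j) ∈ E → x ∈ groupConeFacet G i j hij}

/-- The dimension of a subset of a real vector space: the dimension of its affine span. -/
noncomputable def affineDim {V : Type*} [AddCommGroup V] [Module ℝ V] (F : Set V) : ℕ :=
  Module.finrank ℝ (affineSpan ℝ F).direction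

/-- The relative interior of a face `F` of `C(G)`: the points of `F` that do not lie in a face
of dimension strictly smaller than that of `F`. -/
def faceRelInterior (G : Type*) [AddCommGroup G] (F : Set ({g : G // g ≠ 0} → ℝ)) :
    Set ({g : G // g ≠ 0} → ℝ) :=
  {x | x ∈ F ∧ ∀ F', IsGroupConeFace G F' → affineDim F' < affineDim F → x ∉ F'}

/-- A numerical semigroup is an additive submonoid of `ℕ` with finite complement. -/
def IsNumericalSemigroup (S : AddSubmonoid ℕ) : Prop :=
  ((S : Set ℕ)ᶜ).Finite

/-- The Apéry set `Ap(S; m)`: the elements `n` of `S` such that `n - m` (computed in `ℤ`)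
is not in `S`. -/
def aperySet (S : AddSubmonoid ℕ) (m : ℕ) : Set ℕ :=
  {n | n ∈ S ∧ ∀ s ∈ S, n ≠ s + m}

/-- The Apéry tuple of `S` with respect to `m`: its coordinate at `i ≠ 0` in `ℤ/m` is the element
of `Ap(S; m)` congruent to `i`. There is exactly one such element when `S` is a numerical semigroup
containing `m ≥ 1`, so the infimum is that element. -/
noncomputable def aperyTuple (S : AddSubmonoid ℕ) (m : ℕ) : {g : ZMod m // g ≠ 0} → ℝ :=
  fun i => ((sInf {n : ℕ | n ∈ aperySet S m ∧ (n : ZMod m) = i} : ℕ) : ℝ)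

/-- A subset `F` of `ℝ^(m - 1)` is a face of `C(ℤ/m)` that contains the numerical semigroup `S`:
the Apéry tuple of `S` lies in the relative interior of `F`. -/
def IsFaceContaining (m : ℕ) (S : AddSubmonoid ℕ) (F : Set ({g : ZMod m // g ≠ 0} → ℝ)) : Prop :=
  IsGroupConeFace (ZMod m) F ∧ aperyTuple S m ∈ faceRelInterior (ZMod m) F

/-- The set `{a, ah + d, ah + 2d, …, ah + kd}`. -/
def arithGens (a h k : ℕ) (d : ℤ) : Set ℕ :=
  {n | n = a ∨ ∃ i : ℕ, 1 ≤ i ∧ i ≤ k ∧ (n : ℤ) = (a : ℤ) * h + i * d}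

/-- The semigroup `⟨a, ah + d, ah + 2d, …, ah + kd⟩`. -/
def arithSemigroup (a h k : ℕ) (d : ℤ) : AddSubmonoid ℕ :=
  AddSubmonoid.closure (arithGens a h k d)

/-- No element of `A` is in the submonoid generated by the others, that is, `A` is a minimal
generating set of the submonoid that it generates. -/
def IsMinimalGeneratingSet (A : Set ℕ) : Prop :=
  ∀ n ∈ A, n ∉ AddSubmonoid.closure (A \ {n})

/-- The parameters of an extra-generalized arithmetical numerical semigroup. The minimality of the
listed generators is automatic for `0 < d`, but not for `d < 0`. -/
structure IsExtraGenArith (a h k : ℕ) (d : ℤ) : Prop where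
  one_le_h : 1 ≤ h
  one_le_k : 1 ≤ k
  k_lt_a : k < a
  coprime : IsCoprime (a : ℤ) d
  lt_last : (a : ℤ) < (a : ℤ) * h + k * d
  minimal : d < 0 → IsMinimalGeneratingSet (arithGens a h k d)

/-! Everything is decided by the relations that are tight at the Apéry tuple x₀. The cone has
finitely many inequalities, so x₀ can be moved slightly in any direction that preserves the tight
ones. Hence the smallest face through x₀ has the dimension of the solution space of the tight
relations (`vectorSpan_minimalFace`), and it is the only face with x₀ in its relative interior.

Since d is a unit mod a, the nonzero classes are i·d with 1 ≤ i < a. The Apéry element there is w_i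
= ⌈i/k⌉ah + id, because ⌈i/k⌉ is the least number of generators other than a whose indices sum to i.
The hypotheses on d force w_i < w_{i+a} (`arithApery_add_lt`), so relations whose indices sum past a
are never tight. For i + j < a, tightness means ⌈i/k⌉ + ⌈j/k⌉ = ⌈(i+j)/k⌉
(`mem_tightSubmodule_iff`). This depends only on a and k, and the four dimensions follow by linear
algebra. -/

/-! ### Faces of the group cone and their relative interiors -/

/-- The linear subspace of vectors satisfying with equality every relation of the group cone that is
tight at `x₀`. -/
def tightSubmodule (G : Type*) [AddCommGroup G] (x₀ : {g : G // g ≠ 0} → ℝ) :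
    Submodule ℝ ({g : G // g ≠ 0} → ℝ) where
  carrier := {v | ∀ i j : {g : G // g ≠ 0}, ∀ hij : (i : G) + j ≠ 0,
    x₀ i + x₀ j = x₀ ⟨(i : G) + j, hij⟩ → v i + v j = v ⟨(i : G) + j, hij⟩}
  add_mem' := by
    intro v w hv hw i j hij h
    have h1 := hv i j hij h
    have h2 := hw i j hij h
    simp only [Pi.add_apply]
    linarith
  zero_mem' := by
    intro i j hij _
    simp
  smul_mem' := by
    intro c v hv i j hij h
    have h1 := hv i j hij h
    simp only [Pi.smul_apply, smul_eq_mul]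
    rw [← h1]
    ring

/-- The smallest face of the group cone through `x₀`. -/
def minimalFace (G : Type*) [AddCommGroup G] (x₀ : {g : G // g ≠ 0} → ℝ) :
    Set ({g : G // g ≠ 0} → ℝ) :=
  {x | x ∈ groupCone G ∧ x ∈ tightSubmodule G x₀}

section

variable {G : Type*} [AddCommGroup G] {x₀ : {g : G // g ≠ 0} → ℝ}

theorem isGroupConeFace_minimalFace (x₀ : {g : G // g ≠ 0} → ℝ) :
    IsGroupConeFace G (minimalFace G x₀) := by
  -- Pairs with zero sum belong to this collection vacuously and impose no condition.
  refine ⟨{p | ∀ hij : (p.1 : G) + p.2 ≠ 0, x₀ p.1 + x₀ p.2 = x₀ ⟨(p.1 : G) + p.2, hij⟩}, ?_⟩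
  ext x
  constructor
  · rintro ⟨hx, ht⟩
    exact ⟨hx, fun i j hij h => ⟨hx, ht i j hij (h hij)⟩⟩
  · rintro ⟨hx, ht⟩
    exact ⟨hx, fun i j hij h => (ht i j hij fun _ => h).2⟩

theorem self_mem_minimalFace (hx₀ : x₀ ∈ groupCone G) : x₀ ∈ minimalFace G x₀ :=
  ⟨hx₀, fun _ _ _ h => h⟩

theorem minimalFace_subset {F : Set ({g : G // g ≠ 0} → ℝ)} (hF : IsGroupConeFace G F)
    (hx₀ : x₀ ∈ F) : minimalFace G x₀ ⊆ F := by
  obtain ⟨E, rfl⟩ := hF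
  rintro x ⟨hx, ht⟩
  exact ⟨hx, fun i j hij h => ⟨hx, ht i j hij (hx₀.2 i j hij h).2⟩⟩

/-- Inequalities strict at x₀ stay strict for small t, tight ones stay equalities along v, and there
are only finitely many of them. -/
theorem exists_pos_add_smul_mem_groupCone [Finite G] (hx₀ : x₀ ∈ groupCone G)
    {v : {g : G // g ≠ 0} → ℝ} (hv : v ∈ tightSubmodule G x₀) :
    ∃ t : ℝ, 0 < t ∧ x₀ + t • v ∈ groupCone G := by
  have key : ∀ᶠ t : ℝ in nhdsWithin 0 (Set.Ioi 0), x₀ + t • v ∈ groupCone G := by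
    refine Filter.eventually_all.2 fun i => Filter.eventually_all.2 fun j =>
      Filter.eventually_all.2 fun hij => ?_
    rcases (hx₀ i j hij).lt_or_eq with h | h
    · refine Filter.Eventually.filter_mono nhdsWithin_le_nhds ?_
      have hc : ∀ᶠ t : ℝ in nhds 0, x₀ ⟨(i : G) + j, hij⟩ + t * v ⟨(i : G) + j, hij⟩
          < (x₀ i + t * v i) + (x₀ j + t * v j) := by
        apply ContinuousAt.eventually_lt
        · fun_prop
        · fun_prop
        · simpa using h
      filter_upwards [hc] with t ht
      simpa using ht.le
    · refine Filter.Eventually.of_forall fun t => ?_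
      have h1 := hv i j hij h.symm
      simp only [Pi.add_apply, Pi.smul_apply, smul_eq_mul]
      rw [h, ← h1]
      apply le_of_eq
      ring
  obtain ⟨t, ht, ht0⟩ := (key.and self_mem_nhdsWithin).exists
  exact ⟨t, ht0, ht⟩

theorem vectorSpan_minimalFace [Finite G] (hx₀ : x₀ ∈ groupCone G) :
    vectorSpan ℝ (minimalFace G x₀) = tightSubmodule G x₀ := by
  apply le_antisymm
  · rw [vectorSpan_def, Submodule.span_le]
    rintro _ ⟨x, hx, y, hy, rfl⟩
    exact (tightSubmodule G x₀).sub_mem hx.2 hy.2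
  · intro v hv
    obtain ⟨t, ht, hmem⟩ := exists_pos_add_smul_mem_groupCone hx₀ hv
    have h1 : x₀ + t • v ∈ minimalFace G x₀ :=
      ⟨hmem, (tightSubmodule G x₀).add_mem (self_mem_minimalFace hx₀).2
        ((tightSubmodule G x₀).smul_mem t hv)⟩
    have h2 := vsub_mem_vectorSpan ℝ h1 (self_mem_minimalFace hx₀)
    have h3 : (x₀ + t • v) -ᵥ x₀ = t • v := by simp
    rw [h3] at h2
    have h4 := (vectorSpan ℝ (minimalFace G x₀)).smul_mem t⁻¹ h2
    rwa [smul_smul, inv_mul_cancel₀ ht.ne', one_smul] at h4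

theorem affineDim_minimalFace [Finite G] (hx₀ : x₀ ∈ groupCone G) :
    affineDim (minimalFace G x₀) = Module.finrank ℝ (tightSubmodule G x₀) := by
  rw [affineDim, direction_affineSpan, vectorSpan_minimalFace hx₀]

theorem mem_faceRelInterior_minimalFace [Finite G] (hx₀ : x₀ ∈ groupCone G) :
    x₀ ∈ faceRelInterior G (minimalFace G x₀) := by
  refine ⟨self_mem_minimalFace hx₀, fun F hF hlt hx => hlt.not_ge ?_⟩
  rw [affineDim, affineDim, direction_affineSpan, direction_affineSpan]
  exact Submodule.finrank_mono (vectorSpan_mono ℝ (minimalFace_subset hF hx))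

/-- The minimal face lies in F and cannot have smaller dimension, so the two have the same direction
space. Every point of F then differs from x₀ by a tight vector. -/
theorem eq_minimalFace_of_mem_faceRelInterior [Finite G] {F : Set ({g : G // g ≠ 0} → ℝ)}
    (hF : IsGroupConeFace G F) (hx₀ : x₀ ∈ faceRelInterior G F) : F = minimalFace G x₀ := by
  have hcone : ∀ x ∈ F, x ∈ groupCone G := by
    obtain ⟨E, rfl⟩ := hF
    exact fun x hx => hx.1
  have hc := hcone x₀ hx₀.1
  have hsub := minimalFace_subset hF hx₀.1
  have hle : affineDim F ≤ affineDim (minimalFace G x₀) := by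
    by_contra! hlt
    exact hx₀.2 _ (isGroupConeFace_minimalFace x₀) hlt (self_mem_minimalFace hc)
  rw [affineDim, affineDim, direction_affineSpan, direction_affineSpan] at hle
  have hspan := Submodule.eq_of_le_of_finrank_le (vectorSpan_mono ℝ hsub) hle
  rw [vectorSpan_minimalFace hc] at hspan
  refine Set.Subset.antisymm (fun x hx => ⟨hcone x hx, ?_⟩) hsub
  have h1 : x -ᵥ x₀ ∈ tightSubmodule G x₀ := by
    rw [hspan]
    exact vsub_mem_vectorSpan ℝ hx hx₀.1
  have h2 := (tightSubmodule G x₀).add_mem h1 (self_mem_minimalFace hc).2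
  simpa using h2

end

/-! ### Coordinates on the cone indexed by the multiples of d -/

section

variable {a : ℕ} {d : ℤ}

/-- Evaluation of a vector at the residue class of `n * d`, with the value `0` at the class `0`. -/
noncomputable def evalMultiple (a : ℕ) (d : ℤ) (n : ℕ) :
    ({g : ZMod a // g ≠ 0} → ℝ) →ₗ[ℝ] ℝ :=
  open Classical in
  if h : (n : ZMod a) * (d : ZMod a) ≠ 0 then LinearMap.proj ⟨_, h⟩ else 0

theorem evalMultiple_eq {n : ℕ} {g : {g : ZMod a // g ≠ 0}}
    (h : (n : ZMod a) * (d : ZMod a) = g) (x : {g : ZMod a // g ≠ 0} → ℝ) :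
    evalMultiple a d n x = x g := by
  have hne : (n : ZMod a) * (d : ZMod a) ≠ 0 := h ▸ g.2
  rw [evalMultiple, dif_pos hne]
  simp only [LinearMap.proj_apply]
  congr 1
  exact Subtype.ext h

theorem multiple_injOn (hd : IsCoprime (a : ℤ) d) {m n : ℕ} (hm : m < a) (hn : n < a)
    (h : (m : ZMod a) * (d : ZMod a) = n * d) : m = n := by
  have hu : IsUnit (d : ZMod a) := (ZMod.coe_int_isUnit_iff_isCoprime d a).2 hd
  have h1 := hu.mul_left_injective h
  rw [ZMod.natCast_eq_natCast_iff] at h1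
  exact h1.eq_of_lt_of_lt hm hn

theorem multiple_ne_zero (hd : IsCoprime (a : ℤ) d) {n : ℕ} (h1 : 1 ≤ n) (hn : n < a) :
    (n : ZMod a) * (d : ZMod a) ≠ 0 := by
  intro h
  have := multiple_injOn hd hn (by omega : 0 < a) (by simpa using h)
  omega

theorem exists_multiple_eq (ha : 0 < a) (hd : IsCoprime (a : ℤ) d) (g : ZMod a) :
    ∃ n < a, (n : ZMod a) * (d : ZMod a) = g := by
  have : NeZero a := ⟨ha.ne'⟩
  have hu : IsUnit (d : ZMod a) := (ZMod.coe_int_isUnit_iff_isCoprime d a).2 hd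
  obtain ⟨u, hu⟩ := hu
  refine ⟨(g * (↑u⁻¹ : ZMod a)).val, ZMod.val_lt _, ?_⟩
  rw [ZMod.natCast_zmod_val, ← hu, mul_assoc, Units.inv_mul, mul_one]

theorem exists_pos_multiple_eq (ha : 0 < a) (hd : IsCoprime (a : ℤ) d)
    (g : {g : ZMod a // g ≠ 0}) :
    ∃ n, 1 ≤ n ∧ n < a ∧ (n : ZMod a) * (d : ZMod a) = g := by
  obtain ⟨n, hn, h⟩ := exists_multiple_eq ha hd (g : ZMod a)
  refine ⟨n, ?_, hn, h⟩
  rcases Nat.eq_zero_or_pos n with rfl | h0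
  · exact absurd (by simpa using h.symm) g.2
  · exact h0

theorem exists_evalMultiple_eq (hd : IsCoprime (a : ℤ) d) (f : ℕ → ℝ) :
    ∃ x, ∀ n, 1 ≤ n → n < a → evalMultiple a d n x = f n := by
  classical
  rcases Nat.eq_zero_or_pos a with rfl | ha
  · exact ⟨0, fun n _ h => absurd h (by omega)⟩
  choose r _ hr hrd using exists_pos_multiple_eq ha hd
  refine ⟨fun g => f (r g), fun n h1 hn => ?_⟩
  rw [evalMultiple_eq (g := ⟨_, multiple_ne_zero hd h1 hn⟩) rfl]
  congr 1
  exact multiple_injOn hd (hr _) hn (hrd _)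

theorem eq_zero_of_evalMultiple (ha : 0 < a) (hd : IsCoprime (a : ℤ) d)
    {x : {g : ZMod a // g ≠ 0} → ℝ}
    (h : ∀ n, 1 ≤ n → n < a → evalMultiple a d n x = 0) : x = 0 := by
  funext g
  obtain ⟨n, h1, hn, hg⟩ := exists_pos_multiple_eq ha hd g
  exact (evalMultiple_eq hg x).symm.trans (h n h1 hn)

/-- Makes the carry in ℤ/a explicit: indices add either without wrapping or with a single a
subtracted. An arbitrary P lets the same argument serve the cone inequalities and the tight
equations. -/
theorem forall_classes_iff (ha : 0 < a) (hd : IsCoprime (a : ℤ) d)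
    (P : {g : ZMod a // g ≠ 0} → {g : ZMod a // g ≠ 0} → {g : ZMod a // g ≠ 0} → Prop) :
    (∀ i j : {g : ZMod a // g ≠ 0}, ∀ hij : (i : ZMod a) + j ≠ 0, P i j ⟨(i : ZMod a) + j, hij⟩) ↔
    ∀ i j l : ℕ, ∀ (hi : 1 ≤ i) (hi' : i < a) (hj : 1 ≤ j) (hj' : j < a) (hl : 1 ≤ l) (hl' : l < a),
      (i + j = l ∨ i + j = l + a) → P ⟨_, multiple_ne_zero hd hi hi'⟩
        ⟨_, multiple_ne_zero hd hj hj'⟩ ⟨_, multiple_ne_zero hd hl hl'⟩ := by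
  constructor
  · intro h i j l hi hi' hj hj' hl hl' hij
    have e : (l : ZMod a) * (d : ZMod a) = (i : ZMod a) * d + (j : ZMod a) * d := by
      have : ((i + j : ℕ) : ZMod a) = l := by
        rcases hij with h | h <;> simp [h]
      rw [← add_mul, ← this]
      push_cast
      rfl
    have hne := multiple_ne_zero hd hl hl'
    have := h ⟨_, multiple_ne_zero hd hi hi'⟩ ⟨_, multiple_ne_zero hd hj hj'⟩ (by rwa [e] at hne)
    convert this using 2
  · intro h i j hij
    obtain ⟨m, hm, hm', em⟩ := exists_pos_multiple_eq ha hd i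
    obtain ⟨n, hn, hn', en⟩ := exists_pos_multiple_eq ha hd j
    obtain ⟨l, hl, hl', el⟩ := exists_pos_multiple_eq ha hd ⟨_, hij⟩
    have hmod : m + n = l ∨ m + n = l + a := by
      rcases lt_or_ge (m + n) a with hlt | hge
      · left
        refine multiple_injOn hd hlt hl' ?_
        rw [el]
        push_cast
        rw [add_mul, em, en]
      · right
        have := multiple_injOn hd (m := m + n - a) (n := l) (by omega) hl' (by
          rw [el, Nat.cast_sub hge]
          push_cast
          rw [ZMod.natCast_self, sub_zero, add_mul, em, en])
        omega
    have := h m n l hm hm' hn hn' hl hl' hmod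
    convert this using 1
    · exact Subtype.ext em.symm
    · exact Subtype.ext en.symm
    · exact Subtype.ext el.symm

theorem mem_groupCone_iff_evalMultiple (ha : 0 < a) (hd : IsCoprime (a : ℤ) d)
    {x : {g : ZMod a // g ≠ 0} → ℝ} :
    x ∈ groupCone (ZMod a) ↔ ∀ i j l : ℕ, 1 ≤ i → i < a → 1 ≤ j → j < a → 1 ≤ l → l < a →
      (i + j = l ∨ i + j = l + a) →
      evalMultiple a d l x ≤ evalMultiple a d i x + evalMultiple a d j x := by
  refine (forall_classes_iff ha hd fun i j l => x l ≤ x i + x j).trans ?_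
  refine forall₃_congr fun i j l => forall₃_congr fun hi hi' hj => forall₃_congr fun hj' hl hl' =>
    forall_congr' fun _ => ?_
  rw [evalMultiple_eq (g := ⟨_, multiple_ne_zero hd hi hi'⟩) rfl,
    evalMultiple_eq (g := ⟨_, multiple_ne_zero hd hj hj'⟩) rfl,
    evalMultiple_eq (g := ⟨_, multiple_ne_zero hd hl hl'⟩) rfl]

theorem mem_tightSubmodule_iff_evalMultiple (ha : 0 < a) (hd : IsCoprime (a : ℤ) d)
    {x v : {g : ZMod a // g ≠ 0} → ℝ} :
    v ∈ tightSubmodule (ZMod a) x ↔ ∀ i j l : ℕ, 1 ≤ i → i < a → 1 ≤ j → j < a → 1 ≤ l → l < a →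
      (i + j = l ∨ i + j = l + a) →
      evalMultiple a d i x + evalMultiple a d j x = evalMultiple a d l x →
      evalMultiple a d i v + evalMultiple a d j v = evalMultiple a d l v := by
  refine (forall_classes_iff ha hd fun i j l => x i + x j = x l → v i + v j = v l).trans ?_
  refine forall₃_congr fun i j l => forall₃_congr fun hi hi' hj => forall₃_congr fun hj' hl hl' =>
    forall_congr' fun _ => ?_
  simp only [evalMultiple_eq (g := ⟨_, multiple_ne_zero hd hi hi'⟩) rfl,
    evalMultiple_eq (g := ⟨_, multiple_ne_zero hd hj hj'⟩) rfl,
    evalMultiple_eq (g := ⟨_, multiple_ne_zero hd hl hl'⟩) rfl]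

end

/-! ### Arithmetic of the rounded up quotient -/

/-- The rounded up quotient `⌈n / k⌉`. -/
def ceilQuot (k n : ℕ) : ℕ := (n + k - 1) / k

section

variable {k : ℕ}

theorem ceilQuot_le_iff (hk : 1 ≤ k) {n q : ℕ} : ceilQuot k n ≤ q ↔ n ≤ q * k := by
  rw [ceilQuot, ← Nat.lt_succ_iff, Nat.div_lt_iff_lt_mul hk, Nat.succ_mul]
  omega

theorem le_ceilQuot_mul (hk : 1 ≤ k) (n : ℕ) : n ≤ ceilQuot k n * k :=
  (ceilQuot_le_iff hk).1 le_rfl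

theorem ceilQuot_zero (hk : 1 ≤ k) : ceilQuot k 0 = 0 :=
  Nat.le_zero.1 ((ceilQuot_le_iff hk).2 (Nat.zero_le _))

theorem ceilQuot_eq_one (hk : 1 ≤ k) {n : ℕ} (h1 : 1 ≤ n) (h : n ≤ k) : ceilQuot k n = 1 := by
  refine le_antisymm ((ceilQuot_le_iff hk).2 (by omega)) ?_
  by_contra! h0
  have := (ceilQuot_le_iff hk (n := n) (q := 0)).1 (by omega)
  omega

theorem ceilQuot_add_self (hk : 1 ≤ k) (n : ℕ) : ceilQuot k (n + k) = ceilQuot k n + 1 := by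
  refine le_antisymm ((ceilQuot_le_iff hk).2 ?_) ?_
  · have := le_ceilQuot_mul hk n
    rw [add_mul]
    omega
  · have h1 := le_ceilQuot_mul hk (n + k)
    rcases h : ceilQuot k (n + k) with _ | q
    · rw [h] at h1
      omega
    · rw [h, add_mul] at h1
      have := (ceilQuot_le_iff hk (n := n) (q := q)).2 (by omega)
      omega

theorem ceilQuot_eq_two (hk : 1 ≤ k) {n : ℕ} (h1 : k < n) (h : n ≤ 2 * k) :
    ceilQuot k n = 2 := by
  obtain ⟨m, rfl⟩ := Nat.exists_eq_add_of_lt h1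
  rw [show k + m + 1 = (m + 1) + k by omega, ceilQuot_add_self hk,
    ceilQuot_eq_one hk (by omega) (by omega)]

theorem ceilQuot_mono (hk : 1 ≤ k) {m n : ℕ} (h : m ≤ n) : ceilQuot k m ≤ ceilQuot k n :=
  (ceilQuot_le_iff hk).2 (h.trans (le_ceilQuot_mul hk n))

theorem ceilQuot_add_le (hk : 1 ≤ k) (m n : ℕ) :
    ceilQuot k (m + n) ≤ ceilQuot k m + ceilQuot k n := by
  rw [ceilQuot_le_iff hk, add_mul]
  exact add_le_add (le_ceilQuot_mul hk m) (le_ceilQuot_mul hk n)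

theorem ceilQuot_add_mul (hk : 1 ≤ k) (n q : ℕ) : ceilQuot k (n + q * k) = ceilQuot k n + q := by
  induction q with
  | zero => simp
  | succ q ih => rw [add_mul, one_mul, ← add_assoc, ceilQuot_add_self hk, ih, add_assoc]

theorem ceilQuot_add_div_le (hk : 1 ≤ k) (n a : ℕ) :
    ceilQuot k n + a / k ≤ ceilQuot k (n + a) := by
  rw [← ceilQuot_add_mul hk]
  exact ceilQuot_mono hk (by have := Nat.div_mul_le_self a k; omega)

theorem ceilQuot_one (n : ℕ) : ceilQuot 1 n = n := by
  simp [ceilQuot]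

end

/-! ### The Apéry set of the semigroup -/

/-- The Apéry element `⌈i / k⌉ a h + i d` in the class of `i d`, as an integer. -/
def arithApery (a h k : ℕ) (d : ℤ) (i : ℕ) : ℤ :=
  ceilQuot k i * ((a : ℤ) * h) + i * d

namespace IsExtraGenArith

variable {a h k : ℕ} {d : ℤ}

theorem a_pos (hS : IsExtraGenArith a h k d) : 0 < a := by
  have := hS.k_lt_a
  omega

theorem generator_pos (hS : IsExtraGenArith a h k d) {i : ℕ} (hi : i ≤ k) :
    0 < (a : ℤ) * h + i * d := by
  have h1 := hS.lt_last
  have ha : (0 : ℤ) < a := by exact_mod_cast hS.a_pos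
  have hh : (0 : ℤ) < h := by exact_mod_cast hS.one_le_h
  have hah := mul_pos ha hh
  have hi' : (i : ℤ) ≤ k := by exact_mod_cast hi
  rcases le_or_gt 0 d with hd | hd
  · positivity
  -- For d < 0 the expression decreases in i, and its last value exceeds a.
  · nlinarith

theorem exists_generator (hS : IsExtraGenArith a h k d) {i : ℕ} (h1 : 1 ≤ i) (hi : i ≤ k) :
    ∃ n ∈ arithGens a h k d, (n : ℤ) = (a : ℤ) * h + i * d := by
  have := hS.generator_pos hi
  refine ⟨((a : ℤ) * h + i * d).toNat, Or.inr ⟨i, h1, hi, ?_⟩, ?_⟩ <;>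
  exact Int.toNat_of_nonneg this.le

/-- For `d < 0` this is the minimality of the generator `ah + d`: otherwise it would be a sum of
`⌊a / k⌋` copies of `ah + kd`, one more generator, and copies of `a`. -/
theorem div_mul_add_pos (hS : IsExtraGenArith a h k d) : 0 < ((a / k : ℕ) : ℤ) * h + d := by
  have hk := hS.one_le_k
  have hq : 1 ≤ a / k := (Nat.one_le_div_iff (by omega)).2 hS.k_lt_a.le
  rcases le_or_gt 0 d with hd | hd
  · rcases hd.lt_or_eq with hd | hd
    · positivity
    · have := hS.coprime
      rw [← hd, isCoprime_zero_right, Int.isUnit_iff] at this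
      have := hS.k_lt_a
      omega
  by_contra! hle
  obtain ⟨n, hn, en⟩ := hS.exists_generator le_rfl hk
  obtain ⟨u, hu, eu⟩ := hS.exists_generator hk le_rfl
  have hr : a % k + 1 ≤ k := Nat.mod_lt _ (by omega)
  -- The index a % k + 1 brings the total coefficient of d to a + 1; the p copies of a below then
  -- cancel the excess over ah + d.
  obtain ⟨v, hv, ev⟩ := hS.exists_generator (i := a % k + 1) (by omega) hr
  obtain ⟨p, hp⟩ := Int.eq_ofNat_of_zero_le (a := -(((a / k : ℕ) : ℤ) * h + d)) (by omega)
  have hsum : n = (a / k) * u + v + p * a := by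
    have hdiv : ((a / k : ℕ) : ℤ) * k + ((a % k : ℕ) : ℤ) = a := by
      exact_mod_cast Nat.div_add_mod' a k
    zify
    rw [en, eu, ev]
    push_cast at hp hdiv ⊢
    linear_combination (a : ℤ) * hp - d * hdiv
  have hupos : 0 < u := by
    have := hS.generator_pos le_rfl
    omega
  have hvpos : 0 < v := by
    have := hS.generator_pos hr
    omega
  have hule : u ≤ (a / k) * u := Nat.le_mul_of_pos_left u hq
  refine hS.minimal hd n hn ?_
  rw [hsum]
  have hmem : ∀ w ∈ arithGens a h k d, w < n →
      w ∈ AddSubmonoid.closure (arithGens a h k d \ {n}) := fun w hw hlt =>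
    AddSubmonoid.subset_closure ⟨hw, by simpa using hlt.ne⟩
  rw [← hsum]
  have hfinal : (a / k) * u + v + p * a ∈ AddSubmonoid.closure (arithGens a h k d \ {n}) := by
    refine add_mem (add_mem ?_ ?_) ?_
    · rw [← smul_eq_mul]
      exact nsmul_mem (hmem u hu (by omega)) _
    · exact hmem v hv (by omega)
    · rcases Nat.eq_zero_or_pos p with rfl | hp0
      · simp
      · rw [← smul_eq_mul]
        have : a ≤ p * a := Nat.le_mul_of_pos_left a hp0
        exact nsmul_mem (hmem a (Or.inl rfl) (by omega)) _
  rwa [← hsum] at hfinal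

/-- Adding a raises the ceiling by at least ⌊a/k⌋, so the increase is at least a(⌊a/k⌋h + d), which
is positive. -/
theorem arithApery_add_lt (hS : IsExtraGenArith a h k d) (i : ℕ) :
    arithApery a h k d i < arithApery a h k d (i + a) := by
  have h1 := hS.div_mul_add_pos
  have ha : (0 : ℤ) < a := by exact_mod_cast hS.a_pos
  have h2 : (ceilQuot k i : ℤ) + (a / k : ℕ) ≤ ceilQuot k (i + a) := by
    exact_mod_cast ceilQuot_add_div_le hS.one_le_k i a
  have h3 : 0 ≤ (ceilQuot k (i + a) - (ceilQuot k i + (a / k : ℕ)) : ℤ) * (a * h) :=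
    mul_nonneg (by linarith) (by positivity)
  have h4 := mul_pos ha h1
  simp only [arithApery, Nat.cast_add]
  linarith

theorem modEq_arithApery_add (a h k : ℕ) (d : ℤ) (i q : ℕ) :
    (a : ℤ) ∣ arithApery a h k d (i + q * a) - arithApery a h k d i := by
  refine ⟨(ceilQuot k (i + q * a) - ceilQuot k i) * h + q * d, ?_⟩
  simp only [arithApery]
  push_cast
  ring

theorem arithApery_le_add_mul (hS : IsExtraGenArith a h k d) (i q : ℕ) :
    arithApery a h k d i ≤ arithApery a h k d (i + q * a) := by
  induction q with
  | zero => simp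
  | succ q ih =>
    have := hS.arithApery_add_lt (i + q * a)
    rw [add_mul, one_mul, ← add_assoc]
    linarith

/-- Copies of ah + kd are split off until the index is at most k. -/
theorem exists_mem_eq_arithApery (hS : IsExtraGenArith a h k d) (i : ℕ) :
    ∃ s ∈ arithSemigroup a h k d, (s : ℤ) = arithApery a h k d i := by
  have hk := hS.one_le_k
  induction i using Nat.strong_induction_on with
  | _ i ih =>
    rcases Nat.eq_zero_or_pos i with rfl | hi
    · exact ⟨0, zero_mem _, by simp [arithApery, ceilQuot_zero hk]⟩
    rcases le_or_gt i k with hik | hik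
    · obtain ⟨n, hn, en⟩ := hS.exists_generator hi hik
      refine ⟨n, AddSubmonoid.subset_closure hn, ?_⟩
      rw [en, arithApery, ceilQuot_eq_one hk hi hik]
      simp
    · obtain ⟨n, hn, en⟩ := hS.exists_generator hk le_rfl
      obtain ⟨j, rfl⟩ := Nat.exists_eq_add_of_lt hik
      obtain ⟨s, hs, es⟩ := ih (j + 1) (by omega)
      refine ⟨s + n, add_mem hs (AddSubmonoid.subset_closure hn), ?_⟩
      push_cast
      rw [es, en, arithApery, arithApery, show k + j + 1 = j + 1 + k by omega,
        ceilQuot_add_self hk]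
      push_cast
      ring

/-- A sum of n generators other than a with index sum t ≤ nk satisfies ⌈t/k⌉ ≤ n. Surplus multiples
of ah are absorbed into the multiple of a, and reducing t mod a only lowers the value, by a multiple
of a. -/
theorem exists_of_mem (hS : IsExtraGenArith a h k d) {s : ℕ} (hs : s ∈ arithSemigroup a h k d) :
    ∃ i < a, ∃ p : ℕ, (s : ℤ) = arithApery a h k d i + p * a := by
  have hk := hS.one_le_k
  have key : ∃ n t p : ℕ, t ≤ n * k ∧ (s : ℤ) = n * ((a : ℤ) * h) + t * d + p * a := by
    induction hs using AddSubmonoid.closure_induction with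
    | mem x hx =>
      rcases hx with rfl | ⟨i, _, hi, e⟩
      · exact ⟨0, 0, 1, by simp, by simp⟩
      · exact ⟨1, i, 0, by simpa using hi, by simp [e]⟩
    | zero => exact ⟨0, 0, 0, by simp, by simp⟩
    | add x y _ _ hx hy =>
      obtain ⟨n, t, p, ht, e⟩ := hx
      obtain ⟨n', t', p', ht', e'⟩ := hy
      refine ⟨n + n', t + t', p + p', by rw [add_mul]; omega, ?_⟩
      push_cast
      rw [e, e']
      ring
  obtain ⟨n, t, p, ht, e⟩ := key
  have hc := (ceilQuot_le_iff hk).2 ht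
  obtain ⟨c, rfl⟩ := Nat.exists_eq_add_of_le hc
  have hle := hS.arithApery_le_add_mul (t % a) (t / a)
  obtain ⟨z, hz⟩ := modEq_arithApery_add a h k d (t % a) (t / a)
  rw [Nat.mod_add_div'] at hle hz
  have ha : (0 : ℤ) < a := by exact_mod_cast hS.a_pos
  have hz0 : 0 ≤ z := by
    by_contra! hneg
    have := mul_neg_of_pos_of_neg ha hneg
    linarith
  obtain ⟨w, rfl⟩ := Int.eq_ofNat_of_zero_le hz0
  refine ⟨t % a, Nat.mod_lt _ hS.a_pos, w + c * h + p, ?_⟩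
  rw [e]
  have : (ceilQuot k t : ℤ) * (a * h) + t * d = arithApery a h k d t := rfl
  push_cast
  linear_combination this + hz

theorem mem_of_eq (hS : IsExtraGenArith a h k d) {s i p : ℕ}
    (e : (s : ℤ) = arithApery a h k d i + p * a) : s ∈ arithSemigroup a h k d := by
  obtain ⟨t, ht, et⟩ := hS.exists_mem_eq_arithApery i
  have : s = t + p * a := by
    zify
    rw [e, et]
  have ha : a ∈ arithSemigroup a h k d := AddSubmonoid.subset_closure (Or.inl rfl)
  rw [this, ← smul_eq_mul]
  exact add_mem ht (nsmul_mem ha _)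

theorem intCast_arithApery (a h k : ℕ) (d : ℤ) (i : ℕ) :
    ((arithApery a h k d i : ℤ) : ZMod a) = (i : ZMod a) * (d : ZMod a) := by
  simp [arithApery]

theorem isNumericalSemigroup (hS : IsExtraGenArith a h k d) :
    IsNumericalSemigroup (arithSemigroup a h k d) := by
  choose s hs es using hS.exists_mem_eq_arithApery
  -- The sum is a crude common upper bound for the Apéry elements; any n at or above it exceeds the
  -- one in its class by a multiple of a.
  refine (Set.finite_lt_nat (∑ i ∈ Finset.range a, s i)).subset fun n hn => ?_
  by_contra! hle
  simp only [Set.mem_ofPred_eq, not_lt] at hle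
  refine hn ?_
  obtain ⟨i, hi, e⟩ := exists_multiple_eq hS.a_pos hS.coprime (n : ZMod a)
  have hsn : s i ≤ n :=
    (Finset.single_le_sum (fun _ _ => Nat.zero_le _) (Finset.mem_range.2 hi)).trans hle
  have hdvd : (s i : ZMod a) = n := by
    rw [← e, ← intCast_arithApery a h k d i, ← es]
    simp
  rw [ZMod.natCast_eq_natCast_iff, Nat.modEq_iff_dvd' hsn] at hdvd
  obtain ⟨p, hp⟩ := hdvd
  refine hS.mem_of_eq (i := i) (p := p) ?_
  rw [← es]
  zify [hsn] at hp
  linear_combination hp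

theorem aperyTuple_eq (hS : IsExtraGenArith a h k d) {i : ℕ} (hi : i < a)
    {g : {g : ZMod a // g ≠ 0}} (hg : (i : ZMod a) * (d : ZMod a) = g) :
    aperyTuple (arithSemigroup a h k d) a g = arithApery a h k d i := by
  obtain ⟨s, hs, es⟩ := hS.exists_mem_eq_arithApery i
  have ha : (0 : ℤ) < a := by exact_mod_cast hS.a_pos
  have hclass : ∀ {n j p : ℕ}, j < a → (n : ℤ) = arithApery a h k d j + p * a →
      (n : ZMod a) = g → j = i := by
    intro n j p hj e hn
    refine multiple_injOn hS.coprime hj hi ?_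
    rw [hg, ← hn, ← intCast_arithApery a h k d j]
    have := congrArg (Int.cast : ℤ → ZMod a) e
    simpa using this.symm
  have hsg : (s : ZMod a) = g := by
    rw [← hg, ← intCast_arithApery a h k d i, ← es]
    simp
  have hset : {n : ℕ | n ∈ aperySet (arithSemigroup a h k d) a ∧ (n : ZMod a) = g} = {s} := by
    ext n
    simp only [Set.mem_ofPred_eq, Set.mem_singleton_iff]
    constructor
    · rintro ⟨⟨hn, hn'⟩, hng⟩
      obtain ⟨j, hj, p, e⟩ := hS.exists_of_mem hn
      obtain rfl := hclass hj e hng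
      rcases p with _ | p
      · zify
        rw [e, es]
        simp
      · refine absurd ?_ (hn' (s + p * a) (hS.mem_of_eq (i := j) (p := p) (by simp [es])))
        zify
        rw [e, es]
        push_cast
        ring
    · rintro rfl
      refine ⟨⟨hs, fun t ht e => ?_⟩, hsg⟩
      obtain ⟨j, hj, p, et⟩ := hS.exists_of_mem ht
      obtain rfl := hclass (n := t) hj et (by rw [← hsg, e]; simp)
      have e' : (n : ℤ) = t + a := by exact_mod_cast e
      have : (0 : ℤ) ≤ p * a := by positivity
      linarith
  rw [aperyTuple, hset, csInf_singleton]
  exact_mod_cast congrArg (Int.cast : ℤ → ℝ) es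

theorem evalMultiple_aperyTuple (hS : IsExtraGenArith a h k d) {i : ℕ} (h1 : 1 ≤ i) (hi : i < a) :
    evalMultiple a d i (aperyTuple (arithSemigroup a h k d) a) = arithApery a h k d i := by
  rw [evalMultiple_eq (g := ⟨_, multiple_ne_zero hS.coprime h1 hi⟩) rfl, hS.aperyTuple_eq hi rfl]

theorem arithApery_add_le (a h : ℕ) (d : ℤ) (hk : 1 ≤ k) (i j : ℕ) :
    arithApery a h k d (i + j) ≤ arithApery a h k d i + arithApery a h k d j := by
  have h1 : (ceilQuot k (i + j) : ℤ) ≤ ceilQuot k i + ceilQuot k j := by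
    exact_mod_cast ceilQuot_add_le hk i j
  have h2 := mul_le_mul_of_nonneg_right h1 (by positivity : (0 : ℤ) ≤ a * h)
  simp only [arithApery]
  push_cast
  linarith

theorem aperyTuple_mem_groupCone (hS : IsExtraGenArith a h k d) :
    aperyTuple (arithSemigroup a h k d) a ∈ groupCone (ZMod a) := by
  rw [mem_groupCone_iff_evalMultiple hS.a_pos hS.coprime]
  intro i j l hi hi' hj hj' hl hl' hij
  rw [hS.evalMultiple_aperyTuple hi hi', hS.evalMultiple_aperyTuple hj hj',
    hS.evalMultiple_aperyTuple hl hl']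
  have h1 := arithApery_add_le a h d hS.one_le_k i j
  have h2 := hS.arithApery_add_lt l
  rcases hij with e | e <;> rw [e] at h1
  · exact_mod_cast h1
  · exact_mod_cast h2.le.trans h1

/-- Without a carry the terms in d cancel and ah > 0 leaves equality of ceilings. With a carry, w_i
+ w_j ≥ w_{l+a} > w_l rules out tightness. -/
theorem mem_tightSubmodule_iff (hS : IsExtraGenArith a h k d) {v : {g : ZMod a // g ≠ 0} → ℝ} :
    v ∈ tightSubmodule (ZMod a) (aperyTuple (arithSemigroup a h k d) a) ↔
      ∀ i j : ℕ, 1 ≤ i → 1 ≤ j → i + j < a → ceilQuot k i + ceilQuot k j = ceilQuot k (i + j) →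
        evalMultiple a d i v + evalMultiple a d j v = evalMultiple a d (i + j) v := by
  rw [mem_tightSubmodule_iff_evalMultiple hS.a_pos hS.coprime]
  have hah : (0 : ℤ) < a * h := by
    have := hS.a_pos
    have := hS.one_le_h
    positivity
  constructor
  · intro H i j hi hj hij hc
    refine H i j (i + j) hi (by omega) hj (by omega) (by omega) hij (Or.inl rfl) ?_
    rw [hS.evalMultiple_aperyTuple hi (by omega), hS.evalMultiple_aperyTuple hj (by omega),
      hS.evalMultiple_aperyTuple (by omega) hij]
    norm_cast
    simp only [arithApery]
    rw [← hc]
    push_cast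
    ring
  · intro H i j l hi hi' hj hj' hl hl' hij e
    rw [hS.evalMultiple_aperyTuple hi hi', hS.evalMultiple_aperyTuple hj hj',
      hS.evalMultiple_aperyTuple hl hl'] at e
    norm_cast at e
    rcases hij with rfl | hij
    · refine H i j hi hj hl' ?_
      simp only [arithApery] at e
      push_cast at e
      have : ((ceilQuot k i : ℤ) + ceilQuot k j) * (a * h) = ceilQuot k (i + j) * (a * h) := by
        linarith
      exact_mod_cast mul_right_cancel₀ hah.ne' this
    · have h1 := arithApery_add_le a h d hS.one_le_k i j
      have h2 := hS.arithApery_add_lt l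
      rw [hij] at h1
      omega

end IsExtraGenArith

/-! ### Dimension of the solution space in the four cases -/

/-- A subspace has dimension `n` when a linear map to `ℝⁿ` restricts to a bijection on it. -/
theorem finrank_eq_of_bijOn {V : Type*} [AddCommGroup V] [Module ℝ V] {W : Submodule ℝ V} {n : ℕ}
    (f : V →ₗ[ℝ] (Fin n → ℝ)) (hinj : ∀ v ∈ W, f v = 0 → v = 0)
    (hsurj : ∀ y, ∃ v ∈ W, f v = y) : Module.finrank ℝ W = n := by
  have hb : Function.Bijective (f.domRestrict W) := by
    constructor
    · rw [← LinearMap.ker_eq_bot, LinearMap.ker_eq_bot']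
      exact fun v hv => Subtype.ext (hinj v v.2 hv)
    · intro y
      obtain ⟨v, hv, e⟩ := hsurj y
      exact ⟨⟨v, hv⟩, e⟩
  rw [(LinearEquiv.ofBijective _ hb).finrank_eq, Module.finrank_fin_fun]

namespace IsExtraGenArith

variable {a h k : ℕ} {d : ℤ}

/-- All ceilings equal 1, so no relation is tight and every coordinate is free. -/
theorem finrank_tightSubmodule_of_add_one (hS : IsExtraGenArith a h k d) (hka : k + 1 = a) :
    Module.finrank ℝ (tightSubmodule (ZMod a) (aperyTuple (arithSemigroup a h k d) a)) =
      a - 1 := by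
  have hk := hS.one_le_k
  refine finrank_eq_of_bijOn (LinearMap.pi fun n : Fin (a - 1) => evalMultiple a d (n + 1)) ?_ ?_
  · intro v _ hv
    refine eq_zero_of_evalMultiple hS.a_pos hS.coprime fun n h1 hn => ?_
    have := congrFun hv ⟨n - 1, by omega⟩
    simpa [Nat.sub_add_cancel h1] using this
  · intro y
    obtain ⟨v, hv⟩ := exists_evalMultiple_eq (a := a) hS.coprime
      fun n => if hn : n - 1 < a - 1 then y ⟨n - 1, hn⟩ else 0
    refine ⟨v, ?_, ?_⟩
    · rw [hS.mem_tightSubmodule_iff]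
      intro i j hi hj hij hc
      rw [ceilQuot_eq_one hk hi (by omega), ceilQuot_eq_one hk hj (by omega),
        ceilQuot_eq_one hk (by omega) (by omega)] at hc
      omega
    · funext n
      have := hv (n + 1) (by omega) (by omega)
      simpa using this

/-- Here ⌈n/1⌉ = n, so every relation without a carry is tight and v_n = n v_1. -/
theorem finrank_tightSubmodule_of_k_eq_one (hS : IsExtraGenArith a h k d) (hk1 : k = 1) :
    Module.finrank ℝ (tightSubmodule (ZMod a) (aperyTuple (arithSemigroup a h k d) a)) = 1 := by
  subst hk1
  have hka := hS.k_lt_a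
  refine finrank_eq_of_bijOn (LinearMap.pi fun _ : Fin 1 => evalMultiple a d 1) ?_ ?_
  · intro v hv h0
    rw [hS.mem_tightSubmodule_iff] at hv
    have h0 : evalMultiple a d 1 v = 0 := congrFun h0 0
    refine eq_zero_of_evalMultiple hS.a_pos hS.coprime fun n h1 hn => ?_
    induction n, h1 using Nat.le_induction with
    | base => exact h0
    | succ n hn1 ih =>
      rw [← hv n 1 hn1 le_rfl hn (by simp only [ceilQuot_one]), h0, ih (by omega), add_zero]
  · intro y
    obtain ⟨v, hv⟩ := exists_evalMultiple_eq (a := a) hS.coprime fun n => n * y 0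
    refine ⟨v, ?_, ?_⟩
    · rw [hS.mem_tightSubmodule_iff]
      intro i j hi hj hij _
      rw [hv i hi (by omega), hv j hj (by omega), hv _ (by omega) hij]
      push_cast
      ring
    · funext n
      have := hv 1 le_rfl (by omega)
      rw [Subsingleton.elim n 0]
      simpa using this

/-- The solutions are α⌈n/k⌉ + βn. Comparing the decompositions of k + 1 and k + 2 into two indices
at most k gives v_{n+1} − v_n = v_2 − v_1 for n < k; beyond k, v_n = v_{n−k} + v_k. The bound k + 2
< a makes k + 2 a nonzero class. -/
theorem finrank_tightSubmodule_of_one_lt_of_add_two_lt (hS : IsExtraGenArith a h k d)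
    (hk1 : 1 < k) (hka : k + 2 < a) :
    Module.finrank ℝ (tightSubmodule (ZMod a) (aperyTuple (arithSemigroup a h k d) a)) = 2 := by
  have hk := hS.one_le_k
  refine finrank_eq_of_bijOn (LinearMap.pi fun n : Fin 2 => evalMultiple a d (n + 1)) ?_ ?_
  · intro v hv h0
    rw [hS.mem_tightSubmodule_iff] at hv
    have h1 : evalMultiple a d 1 v = 0 := congrFun h0 0
    have h2 : evalMultiple a d 2 v = 0 := congrFun h0 1
    have hadd : ∀ i j l, 1 ≤ i → 1 ≤ j → i ≤ k → j ≤ k → i + j = l → k < l → l < a →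
        evalMultiple a d i v + evalMultiple a d j v = evalMultiple a d l v := by
      rintro i j _ hi hj hik hjk rfl hl hla
      refine hv i j hi hj hla ?_
      rw [ceilQuot_eq_one hk hi hik, ceilQuot_eq_one hk hj hjk,
        ceilQuot_eq_two hk hl (by omega)]
    have hsmall : ∀ n, 1 ≤ n → n ≤ k → evalMultiple a d n v = 0 := by
      intro n hn
      induction n, hn using Nat.le_induction with
      | base => exact fun _ => h1
      | succ n hn ih =>
        intro hnk
        have e1 := hadd n (k + 1 - n) (k + 1) hn (by omega) (by omega) (by omega) (by omega)
          (by omega) (by omega)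
        have e2 := hadd (n + 1) (k + 1 - n) (k + 2) (by omega) (by omega) (by omega) (by omega)
          (by omega) (by omega) (by omega)
        have e3 := hadd 1 k (k + 1) (by omega) (by omega) (by omega) (by omega) (by omega)
          (by omega) (by omega)
        have e4 := hadd 2 k (k + 2) (by omega) (by omega) (by omega) (by omega) (by omega)
          (by omega) (by omega)
        have := ih (by omega)
        linarith
    refine eq_zero_of_evalMultiple hS.a_pos hS.coprime fun n hn hna => ?_
    induction n using Nat.strong_induction_on with
    | _ n ih =>
      rcases le_or_gt n k with hnk | hnk
      · exact hsmall n hn hnk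
      · have e := hv (n - k) k (by omega) hk (by omega) (by
          rw [ceilQuot_add_self hk, ceilQuot_eq_one hk hk le_rfl])
        rw [Nat.sub_add_cancel hnk.le, ih (n - k) (by omega) (by omega) (by omega),
          hsmall k hk le_rfl, add_zero] at e
        exact e.symm
  · intro y
    -- The coefficients solve α + β = y 0 and α + 2β = y 1, as k ≥ 2 gives ⌈1/k⌉ = ⌈2/k⌉ = 1.
    obtain ⟨v, hv⟩ := exists_evalMultiple_eq (a := a) hS.coprime
      fun n => ceilQuot k n * (2 * y 0 - y 1) + n * (y 1 - y 0)
    refine ⟨v, ?_, ?_⟩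
    · rw [hS.mem_tightSubmodule_iff]
      intro i j hi hj hij hc
      rw [hv i hi (by omega), hv j hj (by omega), hv _ (by omega) hij, ← hc]
      push_cast
      ring
    · have e1 := hv 1 le_rfl (by omega)
      have e2 := hv 2 (by omega) (by omega)
      rw [ceilQuot_eq_one hk (by omega) (by omega)] at e1 e2
      funext n
      fin_cases n
      · refine Eq.trans e1 ?_
        simp
        ring
      · refine Eq.trans e2 ?_
        simp
        ring

/-- Subtracting half of the last coordinate from all coordinates (the one at `0` included) turns
the tight relations into antisymmetry under `i ↦ a - 1 - i`. -/
theorem finrank_tightSubmodule_of_add_two (hS : IsExtraGenArith a h k d) (hka : k + 2 = a) :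
    Module.finrank ℝ (tightSubmodule (ZMod a) (aperyTuple (arithSemigroup a h k d) a)) =
      a / 2 := by
  have hk := hS.one_le_k
  -- Ceilings are 1 up to k = a − 2 and 2 at a − 1, so tightness occurs exactly when the indices sum
  -- to a − 1.
  have hiff : ∀ v, v ∈ tightSubmodule (ZMod a) (aperyTuple (arithSemigroup a h k d) a) ↔
      ∀ i j : ℕ, 1 ≤ i → 1 ≤ j → i + j = a - 1 →
        evalMultiple a d i v + evalMultiple a d j v = evalMultiple a d (a - 1) v := by
    intro v
    rw [hS.mem_tightSubmodule_iff]
    constructor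
    · intro H i j hi hj hij
      rw [← hij]
      refine H i j hi hj (by omega) ?_
      rw [ceilQuot_eq_one hk hi (by omega), ceilQuot_eq_one hk hj (by omega),
        ceilQuot_eq_two hk (by omega) (by omega)]
    · intro H i j hi hj hij hc
      rcases Nat.lt_or_ge (i + j) (a - 1) with hlt | hge
      · rw [ceilQuot_eq_one hk hi (by omega), ceilQuot_eq_one hk hj (by omega),
          ceilQuot_eq_one hk (by omega) (by omega)] at hc
        omega
      · have e : i + j = a - 1 := by omega
        rw [e]
        exact H i j hi hj e
  have hzero : ∀ v, evalMultiple a d 0 v = 0 := by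
    intro v
    simp [evalMultiple]
  -- Evaluation at n = 0 is 0, so the component n = 0 is minus half the last coordinate and
  -- determines it.
  refine finrank_eq_of_bijOn (LinearMap.pi fun n : Fin (a / 2) =>
    evalMultiple a d n - (1 / 2 : ℝ) • evalMultiple a d (a - 1)) ?_ ?_
  · intro v hv h0
    rw [hiff] at hv
    have hv0 : ∀ n, n < a / 2 → evalMultiple a d n v = 1 / 2 * evalMultiple a d (a - 1) v := by
      intro n hn
      have := congrFun h0 ⟨n, hn⟩
      simp only [LinearMap.pi_apply, LinearMap.sub_apply, LinearMap.smul_apply, smul_eq_mul,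
        Pi.zero_apply] at this
      linarith
    have hlast : evalMultiple a d (a - 1) v = 0 := by
      have := hv0 0 (by omega)
      rw [hzero] at this
      linarith
    rw [hlast] at hv hv0
    simp only [mul_zero] at hv0
    refine eq_zero_of_evalMultiple hS.a_pos hS.coprime fun n hn hna => ?_
    rcases Nat.lt_or_ge n (a / 2) with hlt | hge
    · exact hv0 n hlt
    rcases eq_or_ne n (a - 1) with rfl | hne
    · exact hlast
    have e := hv n (a - 1 - n) hn (by omega) (by omega)
    rcases Nat.lt_or_ge (a - 1 - n) (a / 2) with hlt | hge'
    · rw [hv0 _ hlt] at e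
      linarith
    -- Only the middle index for odd a is left; it is its own mirror image, so its relation reads
    -- 2v_n = 0.
    · rw [show a - 1 - n = n by omega] at e
      linarith
  · intro y
    obtain ⟨f, hf⟩ : ∃ f : ℕ → ℝ, ∀ n (hn : n < a / 2), f n = y ⟨n, hn⟩ :=
      ⟨fun n => if hn : n < a / 2 then y ⟨n, hn⟩ else 0, fun n hn => dif_pos hn⟩
    -- The antisymmetric extension of y; the value 0 is for the middle index when a is odd.
    -- Subtracting g 0 below normalizes the value at index 0 to 0.
    obtain ⟨g, hg⟩ : ∃ g : ℕ → ℝ, ∀ n, g n =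
        if n < a / 2 then f n else if a - 1 - n < a / 2 then - f (a - 1 - n) else 0 :=
      ⟨_, fun _ => rfl⟩
    have hanti : ∀ i j, i + j = a - 1 → g i + g j = 0 := by
      intro i j hij
      rw [hg, hg, show a - 1 - i = j by omega, show a - 1 - j = i by omega]
      split_ifs <;> first | omega | ring
    obtain ⟨v, hv⟩ := exists_evalMultiple_eq (a := a) hS.coprime fun n => g n - g 0
    have hlast : evalMultiple a d (a - 1) v = -2 * g 0 := by
      rw [hv _ (by omega) (by omega)]
      have := hanti 0 (a - 1) (by omega)
      linarith
    refine ⟨v, ?_, ?_⟩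
    · rw [hiff]
      intro i j hi hj hij
      rw [hlast, hv i hi (by omega), hv j hj (by omega)]
      have := hanti i j hij
      linarith
    · funext n
      have hgn : g n = y n := by rw [hg, if_pos n.2, hf]
      simp only [LinearMap.pi_apply, LinearMap.sub_apply, LinearMap.smul_apply, smul_eq_mul]
      rw [hlast, ← hgn]
      rcases Nat.eq_zero_or_pos (n : ℕ) with h0 | h0
      · rw [h0, hzero]
        ring
      · rw [hv n h0 (by omega)]
        ring

end IsExtraGenArith

/-! ### The main theorem -/

theorem theoremt (a h k : ℕ) (d : ℤ) (hS : IsExtraGenArith a h k d) :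
    IsNumericalSemigroup (arithSemigroup a h k d) ∧
    (∃! F : Set ({g : ZMod a // g ≠ 0} → ℝ), IsFaceContaining a (arithSemigroup a h k d) F) ∧
    ∀ F : Set ({g : ZMod a // g ≠ 0} → ℝ), IsFaceContaining a (arithSemigroup a h k d) F →
      (k + 1 = a → affineDim F = a - 1) ∧
      (k + 2 = a → affineDim F = a / 2) ∧
      (1 < k ∧ k + 2 < a → affineDim F = 2) ∧
      (k = 1 → affineDim F = 1) := by
  have : NeZero a := ⟨hS.a_pos.ne'⟩
  have hcone := hS.aperyTuple_mem_groupCone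
  have huniq : ∀ F : Set ({g : ZMod a // g ≠ 0} → ℝ),
      IsFaceContaining a (arithSemigroup a h k d) F →
        F = minimalFace (ZMod a) (aperyTuple (arithSemigroup a h k d) a) :=
    fun F hF => eq_minimalFace_of_mem_faceRelInterior hF.1 hF.2
  refine ⟨hS.isNumericalSemigroup,
    ⟨_, ⟨isGroupConeFace_minimalFace _, mem_faceRelInterior_minimalFace hcone⟩, huniq⟩, ?_⟩
  intro F hF
  rw [huniq F hF, affineDim_minimalFace hcone]
  exact ⟨hS.finrank_tightSubmodule_of_add_one, hS.finrank_tightSubmodule_of_add_two,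
    fun hk => hS.finrank_tightSubmodule_of_one_lt_of_add_two_lt hk.1 hk.2,
    hS.finrank_tightSubmodule_of_k_eq_one⟩
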